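/- A quandle is a non-empty set $X$ with a binary operation $*$ such that $x*x=x$ for all $x\in X$, every right multiplication $S_y\colon x\mapsto x*y$ is a bijection of $X$, and $(x*y)*z=(x*z)*(y*z)$ for all $x,y,z\in X$. Let $\mathbb{Z}[X]$ be the integral quandle ring of $X$, that is, the free $\mathbb{Z}$-module with basis $\{e_x \mid x\in X\}$ and with the (in general non-associative) product $$\Big(\sum_{x}\alpha_x e_x\Big)\Big(\sum_{y}\beta_y e_y\Big)=\sum_{x,y}\alpha_x\beta_y\, e_{x*y}.$$ An idempotent of $\mathbb{Z}[X]$ is a non-zero element $u$ with $u^2=u$; the basis elements $e_x$ are idempotents, called trivial. **Theorem 5.3.** Let $n\ge 1$ be an integer and let $FQ_n$ be the free quandle of rank $n$, i.e. the quandle presented by $n$ generators and no relations. Then $\mathbb{Z}[FQ_n]$ has only trivial idempotents: the set of idempotents of $\mathbb{Z}[FQ_n]$ is exactly $\{e_x \mid x\in FQ_n\}$. -/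

import Mathlib

/-! Quandles are Mathlib's `Quandle`, in which the operation is written as a left action.
The right-handed operation `x * y` (each right multiplication `x ↦ x * y` is an automorphism
fixing `y`) is `Shelf.act y x`, and `x *⁻¹ y` is `Rack.invAct y x`. -/

/-- Formal quandle words in the letters `S`. -/
inductive QuandleWord (S : Type*) : Type _
  | of (s : S) : QuandleWord S
  | act (x y : QuandleWord S) : QuandleWord S
  | invAct (x y : QuandleWord S) : QuandleWord S

/-- The congruence on quandle words generated by the quandle axioms and nothing else. -/
inductive QuandleWord.Rel {S : Type*} : QuandleWord S → QuandleWord S → Prop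
  | refl (a : QuandleWord S) : Rel a a
  | symm {a b : QuandleWord S} (h : Rel a b) : Rel b a
  | trans {a b c : QuandleWord S} (h : Rel a b) (h' : Rel b c) : Rel a c
  | congr_act {a a' b b' : QuandleWord S} (h : Rel a a') (h' : Rel b b') :
      Rel (act a b) (act a' b')
  | congr_invAct {a a' b b' : QuandleWord S} (h : Rel a a') (h' : Rel b b') :
      Rel (invAct a b) (invAct a' b')
  | self_distrib (a b c : QuandleWord S) :
      Rel (act a (act b c)) (act (act a b) (act a c))
  | left_inv (a b : QuandleWord S) : Rel (invAct a (act a b)) b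
  | right_inv (a b : QuandleWord S) : Rel (act a (invAct a b)) b
  | fix (a : QuandleWord S) : Rel (act a a) a

instance QuandleWord.setoid (S : Type*) : Setoid (QuandleWord S) where
  r := QuandleWord.Rel
  iseqv := ⟨Rel.refl, Rel.symm, Rel.trans⟩

/-- The free quandle on the set `S`: the quandle presented by the generators `S` and no
relations. -/
def FreeQuandle (S : Type*) : Type _ := Quotient (QuandleWord.setoid S)

namespace FreeQuandle

/-- The class of a quandle word. -/
def mk {S : Type*} (w : QuandleWord S) : FreeQuandle S :=
  Quotient.mk (QuandleWord.setoid S) w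

/-- The inclusion of the generators. -/
def of {S : Type*} (s : S) : FreeQuandle S := mk (QuandleWord.of s)

instance {S : Type*} : Quandle (FreeQuandle S) where
  act := Quotient.map₂ QuandleWord.act
    (fun _ _ h _ _ h' => QuandleWord.Rel.congr_act h h')
  invAct := Quotient.map₂ QuandleWord.invAct
    (fun _ _ h _ _ h' => QuandleWord.Rel.congr_invAct h h')
  self_distrib := by
    rintro ⟨a⟩ ⟨b⟩ ⟨c⟩
    exact Quotient.sound (QuandleWord.Rel.self_distrib a b c)
  left_inv := by
    rintro ⟨a⟩ ⟨b⟩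
    exact Quotient.sound (QuandleWord.Rel.left_inv a b)
  right_inv := by
    rintro ⟨a⟩ ⟨b⟩
    exact Quotient.sound (QuandleWord.Rel.right_inv a b)
  fix := by
    rintro ⟨a⟩
    exact Quotient.sound (QuandleWord.Rel.fix a)

end FreeQuandle

/-- Evaluation of a quandle word in a quandle. -/
def QuandleWord.eval {S Q : Type*} [Quandle Q] (f : S → Q) : QuandleWord S → Q
  | of s => f s
  | act x y => Shelf.act (x.eval f) (y.eval f)
  | invAct x y => Rack.invAct (x.eval f) (y.eval f)

theorem QuandleWord.eval_eq_of_rel {S Q : Type*} [Quandle Q] (f : S → Q)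
    {a b : QuandleWord S} (h : QuandleWord.Rel a b) : a.eval f = b.eval f := by
  induction h with
  | refl a => rfl
  | symm _ ih => exact ih.symm
  | trans _ _ ih ih' => exact ih.trans ih'
  | congr_act _ _ ih ih' => simp only [eval, ih, ih']
  | congr_invAct _ _ ih ih' => simp only [eval, ih, ih']
  | self_distrib a b c => exact Shelf.self_distrib
  | left_inv a b => exact Rack.left_inv _ _
  | right_inv a b => exact Rack.right_inv _ _
  | fix a => exact Quandle.fix

/-- The universal property of the free quandle: a map from `S` to a quandle extends uniquely to
a quandle homomorphism. -/
theorem FreeQuandle.existsUnique_hom {S Q : Type*} [Quandle Q] (f : S → Q) :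
    ∃! φ : ShelfHom (FreeQuandle S) Q, ∀ s, φ.toFun (FreeQuandle.of s) = f s := by
  refine ⟨⟨Quotient.lift (QuandleWord.eval f) fun _ _ h => QuandleWord.eval_eq_of_rel f h, ?_⟩,
    fun s => rfl, ?_⟩
  · rintro ⟨a⟩ ⟨b⟩
    rfl
  · rintro φ hφ
    apply ShelfHom.ext
    funext x
    obtain ⟨a⟩ := x
    change φ.toFun (mk a) = a.eval f
    induction a with
    | of s => exact hφ s
    | act x y ihx ihy =>
      have h := φ.map_act' (x := mk x) (y := mk y)
      rw [ihx, ihy] at h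
      exact h
    | invAct x y ihx ihy =>
      have h := φ.map_act' (x := mk x) (y := Rack.invAct (mk x) (mk y))
      rw [Rack.right_inv (mk x) (mk y), ihx, ihy] at h
      change φ.toFun (Rack.invAct (mk x) (mk y)) = Rack.invAct (x.eval f) (y.eval f)
      rw [h]
      exact (Rack.left_inv _ _).symm

/-- The underlying module of the quandle ring `k[X]`: formal finite sums `∑ α_x e_x`. -/
def QuandleRing (k X : Type*) [Zero k] : Type _ := X →₀ k

namespace QuandleRing

noncomputable instance {k X : Type*} [CommRing k] : AddCommGroup (QuandleRing k X) :=
  inferInstanceAs (AddCommGroup (X →₀ k))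

noncomputable instance {k X : Type*} [CommRing k] : Module k (QuandleRing k X) :=
  inferInstanceAs (Module k (X →₀ k))

/-- The basis element `e_x` of the quandle ring `k[X]`. -/
noncomputable def e (k : Type*) {X : Type*} [CommRing k] (x : X) : QuandleRing k X :=
  Finsupp.single x (1 : k)

/-- The product `(∑ α_x e_x) (∑ β_y e_y) = ∑ α_x β_y e_{x * y}` on formal sums, where `x * y`
is `Shelf.act y x`. -/
noncomputable def mulAux {k X : Type*} [CommRing k] [Quandle X] (u v : X →₀ k) : X →₀ k :=
  u.sum fun x a => v.sum fun y b => Finsupp.single (Shelf.act y x) (a * b)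

noncomputable instance {k X : Type*} [CommRing k] [Quandle X] : Mul (QuandleRing k X) where
  mul u v := mulAux (k := k) (X := X) u v

theorem mulAux_add {k X : Type*} [CommRing k] [Quandle X] (u v w : X →₀ k) :
    mulAux u (v + w) = mulAux u v + mulAux u w := by
  unfold mulAux
  rw [← Finsupp.sum_add]
  refine Finsupp.sum_congr fun x _ => ?_
  exact Finsupp.sum_add_index' (fun y => by simp) (fun y b c => by simp [mul_add])

theorem add_mulAux {k X : Type*} [CommRing k] [Quandle X] (u v w : X →₀ k) :
    mulAux (u + v) w = mulAux u w + mulAux v w := by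
  unfold mulAux
  refine Finsupp.sum_add_index' (fun x => by simp) (fun x a b => ?_)
  rw [← Finsupp.sum_add]
  exact Finsupp.sum_congr fun y _ => by simp [add_mul]

/-- The quandle ring is a ring, in general neither associative nor unital. -/
noncomputable instance {k X : Type*} [CommRing k] [Quandle X] :
    NonUnitalNonAssocRing (QuandleRing k X) where
  left_distrib u v w := mulAux_add (k := k) (X := X) u v w
  right_distrib u v w := add_mulAux (k := k) (X := X) u v w
  zero_mul u := by
    change mulAux (k := k) (X := X) 0 u = 0
    exact Finsupp.sum_zero_index
  mul_zero u := by
    change mulAux (k := k) (X := X) u 0 = 0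
    exact Finset.sum_eq_zero fun x _ => Finsupp.sum_zero_index

/-- The set of idempotents of the quandle ring: the non-zero `u` with `u² = u`. -/
def idempotents (k X : Type*) [CommRing k] [Quandle X] : Set (QuandleRing k X) :=
  {u | u ≠ 0 ∧ u * u = u}

end QuandleRing

/-! The proof works for the free quandle on any set of generators.

Let `F` be the free group on the generators. It acts on the free quandle, every element of the
free quandle is a translate `g • s` of a generator, and `g • s` determines the coset `g⟨s⟩`: a line
labelled `s` in the Cayley tree of `F`. The operation `act m k` moves the line `k` by one unit along
the line `m`. The geometric input is that, if two lines `k`, `k'` have different nearest points on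
a third line `m`, then the path from `k` to `k'` runs along `m`, so `k` and `k'` are further from
each other than either is from `m` (`FreeQuandle.lineDist_lt_of_ne`). In terms of words this says
that there is no cancellation in `f₁⁻¹ y ^ c f₂` when `c ≠ 0` and the reduced words of `f₁`, `f₂` do
not begin with `y` or `y⁻¹` (`FreeGroup.toWord_inv_mul_zpow_mul`).

Suppose now that the finite support of an idempotent `u` has at least two elements, and choose
`l ≠ m` in it at maximal distance. The line `act m l` projects to `m` one unit further than `l`
does. Comparing it with `l` shows that it is too far from `l` to lie in the support. If
`act m l = act m' l'` is another product of elements of the support, then `m' ≠ m`, and `m'`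
differs in its projection to `m` either from `l` or from `act m l`, so it is too far from `l`, or
`act m l = act m' l'` is too far from `m'`, although its distance to `m'` is that of `l'` to `m'`.
Hence the product has a unique representation (`FreeQuandle.exists_uniqueProduct_notMem`), its
coefficient in `u * u` is a product of two non-zero numbers, and its coefficient in `u` is zero: a
contradiction. So `u = a e_x` with `a * a = a`. -/

/-! ### Words in the free group -/

namespace FreeGroup

variable {α : Type*} [DecidableEq α]

/-- The reduced word of `f` does not begin with `y` or `y⁻¹`. The empty word is allowed. -/
def AvoidsHead (y : α) (f : FreeGroup α) : Prop :=
  ∀ p ∈ f.toWord.head?, p.1 ≠ y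

theorem toWord_of_zpow (y : α) {c : ℤ} (hc : c ≠ 0) :
    ∃ n b, n ≠ 0 ∧ (of y ^ c).toWord = List.replicate n (y, b) := by
  obtain ⟨n, rfl | rfl⟩ := c.eq_nat_or_neg
  · exact ⟨n, true, by simpa using hc, by rw [zpow_natCast, toWord_of_pow]⟩
  · refine ⟨n, false, by simpa using hc, ?_⟩
    rw [zpow_neg, zpow_natCast, toWord_inv, toWord_of_pow]
    simp [invRev]

theorem toWord_inv_mul_zpow_mul {y : α} {f₁ f₂ : FreeGroup α} (h₁ : AvoidsHead y f₁)
    (h₂ : AvoidsHead y f₂) {c : ℤ} (hc : c ≠ 0) :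
    ∃ n b, n ≠ 0 ∧ (f₁⁻¹ * of y ^ c * f₂).toWord =
      invRev f₁.toWord ++ List.replicate n (y, b) ++ f₂.toWord := by
  obtain ⟨n, b, hn, hw⟩ := toWord_of_zpow y hc
  refine ⟨n, b, hn, ?_⟩
  have hmk : f₁⁻¹ * of y ^ c * f₂ =
      mk (invRev f₁.toWord ++ List.replicate n (y, b) ++ f₂.toWord) := by
    rw [← mul_mk, ← mul_mk, ← hw, ← toWord_inv, mk_toWord, mk_toWord, mk_toWord]
  have hr₁ : IsReduced (invRev f₁.toWord) := toWord_inv f₁ ▸ isReduced_toWord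
  have hrn : IsReduced (List.replicate n (y, b)) := hw ▸ isReduced_toWord
  have hr₂ : IsReduced f₂.toWord := isReduced_toWord
  rw [hmk, toWord_mk]
  apply IsReduced.reduce_eq
  refine IsReduced.append_overlap (List.isChain_append.2 ⟨hr₁, hrn, ?_⟩)
    (List.isChain_append.2 ⟨hrn, hr₂, ?_⟩) (by simpa using hn)
  · intro p hp q hq hpq
    obtain rfl : q = (y, b) := List.eq_of_mem_replicate (List.mem_of_mem_head? hq)
    rw [invRev, List.getLast?_reverse, List.head?_map, Option.mem_def,
      Option.map_eq_some_iff] at hp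
    obtain ⟨r, hr, rfl⟩ := hp
    exact absurd hpq (h₁ r hr)
  · intro p hp q hq hpq
    obtain rfl : p = (y, b) := List.eq_of_mem_replicate (List.mem_of_mem_getLast? hp)
    exact absurd hpq.symm (h₂ q hq)

theorem norm_add_norm_lt {y : α} {f₁ f₂ : FreeGroup α} (h₁ : AvoidsHead y f₁)
    (h₂ : AvoidsHead y f₂) {c : ℤ} (hc : c ≠ 0) :
    norm f₁ + norm f₂ < norm (f₁⁻¹ * of y ^ c * f₂) := by
  obtain ⟨n, b, hn, hw⟩ := toWord_inv_mul_zpow_mul h₁ h₂ hc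
  simp only [norm, hw, List.length_append, invRev_length, List.length_replicate]
  omega

theorem exists_eq_zpow_mul (y : α) (g : FreeGroup α) :
    ∃ (a : ℤ) (f : FreeGroup α), g = of y ^ a * f ∧ AvoidsHead y f := by
  suffices H : ∀ L : List (α × Bool), IsReduced L →
      ∃ (a : ℤ) (f : FreeGroup α), mk L = of y ^ a * f ∧ AvoidsHead y f by
    simpa only [mk_toWord] using H g.toWord isReduced_toWord
  intro L
  induction L with
  | nil =>
    exact fun _ => ⟨0, 1, by simp [one_eq_mk], by simp [AvoidsHead]⟩
  | cons p L ih =>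
    intro hL
    obtain ⟨s, b⟩ := p
    by_cases hs : s = y
    · subst hs
      obtain ⟨a, f, hf, hy⟩ := ih (hL.infix (List.suffix_cons _ _).isInfix)
      have hcons : (mk ((s, b) :: L) : FreeGroup α) = mk [(s, b)] * mk L := by
        rw [mul_mk, List.singleton_append]
      cases b with
      | true =>
        refine ⟨1 + a, f, ?_, hy⟩
        rw [hcons, hf, zpow_add, zpow_one, mul_assoc]
        rfl
      | false =>
        refine ⟨-1 + a, f, ?_, hy⟩
        rw [hcons, hf, zpow_add, zpow_neg_one, mul_assoc]
        rfl
    · refine ⟨0, mk ((s, b) :: L), by simp, ?_⟩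
      intro p hp
      rw [toWord_mk, hL.reduce_eq] at hp
      obtain rfl : (s, b) = p := by simpa using hp
      exact hs

/-- Multiplication on the right by a power of `x` does not create a leading `y`, except when
`x = y` and `f = 1`: if it did, the reduced word of a power of `x` would contain `y` and the whole
word of `f`. -/
theorem AvoidsHead.mul_zpow {x y : α} {f : FreeGroup α} (hf : AvoidsHead y f)
    (hx : ¬(x = y ∧ f = 1)) (j : ℤ) : AvoidsHead y (f * of x ^ j) := by
  obtain ⟨c, f', hc, hf'⟩ := exists_eq_zpow_mul y (f * of x ^ j)
  by_cases hc0 : c = 0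
  · rw [hc, hc0, zpow_zero, one_mul]
    exact hf'
  obtain ⟨n, b, hn, hw⟩ := toWord_inv_mul_zpow_mul hf hf' hc0
  have hj : f⁻¹ * of y ^ c * f' = of x ^ j := by
    rw [mul_assoc, ← hc, inv_mul_cancel_left]
  rw [hj] at hw
  have hall : ∀ p ∈ invRev f.toWord ++ List.replicate n (y, b) ++ f'.toWord, p.1 = x := by
    rw [← hw]
    by_cases hj0 : j = 0
    · simp [hj0]
    · obtain ⟨m, b', -, hm⟩ := toWord_of_zpow x hj0
      rw [hm]
      intro p hp
      rw [List.eq_of_mem_replicate hp]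
  have hyx : y = x := hall (y, b) (by simp [hn])
  refine absurd ⟨hyx.symm, ?_⟩ hx
  rw [← toWord_eq_nil_iff]
  cases hfw : f.toWord with
  | nil => rfl
  | cons p L =>
    refine absurd ?_ (hf p (by simp [hfw]))
    rw [hyx]
    exact hall (p.1, !p.2) (by simp [hfw, invRev])

end FreeGroup

/-! ### Elements of the free quandle as translates of generators -/

namespace FreeQuandle

variable {α : Type*}

/-- The action of the free group on the free quandle, in which a generator `s` acts by
`Shelf.act (of s)`. -/
def groupAct : FreeGroup α →* Equiv.Perm (FreeQuandle α) :=
  FreeGroup.lift fun s => Rack.act' (of s)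

theorem groupAct_of (s : α) (k : FreeQuandle α) :
    groupAct (FreeGroup.of s) k = Shelf.act (of s) k := by
  simp [groupAct]

theorem groupAct_apply_inv (g : FreeGroup α) (k : FreeQuandle α) :
    groupAct g (groupAct g⁻¹ k) = k := by
  rw [← Equiv.Perm.mul_apply, ← map_mul, mul_inv_cancel, map_one, Equiv.Perm.one_apply]

theorem groupAct_act (g : FreeGroup α) (a b : FreeQuandle α) :
    groupAct g (Shelf.act a b) = Shelf.act (groupAct g a) (groupAct g b) := by
  induction g using FreeGroup.induction_on generalizing a b with
  | C1 => simp
  | of s => rw [groupAct_of, groupAct_of, groupAct_of, Shelf.self_distrib]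
  | inv_of s _ =>
    apply (groupAct (FreeGroup.of s)).injective
    rw [groupAct_apply_inv, groupAct_of, Shelf.self_distrib, ← groupAct_of, ← groupAct_of,
      groupAct_apply_inv, groupAct_apply_inv]
  | mul g h hg hh => simp only [map_mul, Equiv.Perm.mul_apply, hg, hh]

/-- The translate `g • s` of a generator. It stands for the coset `g⟨s⟩` of the free group, a line
in the Cayley tree. -/
def translate (g : FreeGroup α) (s : α) : FreeQuandle α := groupAct g (of s)

theorem groupAct_translate (g h : FreeGroup α) (s : α) :
    groupAct g (translate h s) = translate (g * h) s := by
  simp [translate]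

theorem act_translate (g : FreeGroup α) (s : α) (k : FreeQuandle α) :
    Shelf.act (translate g s) k = groupAct (g * FreeGroup.of s * g⁻¹) k := by
  have h := groupAct_act g (of s) (groupAct g⁻¹ k)
  rw [← groupAct_of, groupAct_apply_inv] at h
  rw [map_mul, map_mul, Equiv.Perm.mul_apply, Equiv.Perm.mul_apply, h, translate]

theorem invAct_translate (g : FreeGroup α) (s : α) (k : FreeQuandle α) :
    Rack.invAct (translate g s) k = groupAct (g * FreeGroup.of s * g⁻¹)⁻¹ k := by
  rw [← Rack.left_cancel (translate g s), Rack.right_inv, act_translate, groupAct_apply_inv]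

theorem exists_eq_translate (k : FreeQuandle α) : ∃ g s, k = translate g s := by
  obtain ⟨w⟩ := k
  change ∃ g s, mk w = translate g s
  induction w with
  | of s => exact ⟨1, s, by simp [translate, of]⟩
  | act a b iha ihb =>
    obtain ⟨g, s, ha⟩ := iha
    obtain ⟨h, t, hb⟩ := ihb
    refine ⟨g * FreeGroup.of s * g⁻¹ * h, t, ?_⟩
    change Shelf.act (mk a) (mk b) = _
    rw [ha, hb, act_translate, groupAct_translate]
  | invAct a b iha ihb =>
    obtain ⟨g, s, ha⟩ := iha
    obtain ⟨h, t, hb⟩ := ihb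
    refine ⟨(g * FreeGroup.of s * g⁻¹)⁻¹ * h, t, ?_⟩
    change Rack.invAct (mk a) (mk b) = _
    rw [ha, hb, invAct_translate, groupAct_translate]

theorem translate_mul_zpow (g : FreeGroup α) (s : α) (j : ℤ) :
    translate (g * FreeGroup.of s ^ j) s = translate g s := by
  have h : groupAct (FreeGroup.of s) (of s) = of s := by
    rw [groupAct_of, Quandle.fix]
  rw [translate, map_mul, Equiv.Perm.mul_apply, map_zpow,
    Equiv.Perm.zpow_apply_eq_self_of_apply_eq_self h, translate]

/-- The homomorphism from the free quandle to the conjugation quandle of the free group that fixes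
the generators is equivariant, so it sends `translate g s` to `g * s * g⁻¹`. -/
theorem conj_eq_of_translate_eq {g h : FreeGroup α} {s t : α}
    (e : translate g s = translate h t) :
    g * FreeGroup.of s * g⁻¹ = h * FreeGroup.of t * h⁻¹ := by
  obtain ⟨φ, hφ, -⟩ := existsUnique_hom (Q := Quandle.Conj (FreeGroup α)) FreeGroup.of
  replace hφ : ∀ s, φ (of s) = FreeGroup.of s := hφ
  have key : ∀ (g : FreeGroup α) (k : FreeQuandle α),
      φ (groupAct g k) = (g * (φ k : FreeGroup α) * g⁻¹ : FreeGroup α) := by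
    intro g
    induction g using FreeGroup.induction_on with
    | C1 => simp
    | of s =>
      intro k
      rw [groupAct_of, ShelfHom.map_act, Quandle.conj_act_eq_conj, hφ]
    | inv_of s ih =>
      intro k
      have h := ih (groupAct (FreeGroup.of s)⁻¹ k)
      rw [groupAct_apply_inv] at h
      rw [h]
      group
    | mul g h hg hh =>
      intro k
      rw [map_mul, Equiv.Perm.mul_apply, hg, hh]
      group
  have h := congrArg φ e
  simpa only [translate, key, hφ] using h

variable [DecidableEq α]

theorem eq_of_translate_eq {g h : FreeGroup α} {s t : α}
    (e : translate g s = translate h t) :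
    s = t ∧ ∃ j : ℤ, h = g * FreeGroup.of s ^ j := by
  have hc := conj_eq_of_translate_eq e
  obtain ⟨a, f, hf, hs⟩ := FreeGroup.exists_eq_zpow_mul s (g⁻¹ * h)
  obtain rfl : h = g * (FreeGroup.of s ^ a * f) := by rw [← hf, mul_inv_cancel_left]
  have ht : f⁻¹ * FreeGroup.of s ^ (1 : ℤ) * f = FreeGroup.of t := by
    have hcomm : FreeGroup.of s = FreeGroup.of s ^ a * (f * FreeGroup.of t * f⁻¹) *
        (FreeGroup.of s ^ a)⁻¹ := by
      have h2 := congrArg (fun z => g⁻¹ * z * g) hc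
      simpa [mul_assoc] using h2
    have h3 : FreeGroup.of s = f * FreeGroup.of t * f⁻¹ := by
      have h4 := congrArg (fun z => (FreeGroup.of s ^ a)⁻¹ * z * FreeGroup.of s ^ a) hcomm
      have h5 : (FreeGroup.of s ^ a)⁻¹ * FreeGroup.of s * FreeGroup.of s ^ a =
          FreeGroup.of s := by
        rw [mul_assoc, ← zpow_one_add, add_comm, zpow_add_one, inv_mul_cancel_left]
      simpa [mul_assoc, h5] using h5.symm.trans h4
    rw [zpow_one, h3]
    group
  -- A conjugate of `s` by `f` has length at least `2 * norm f + 1`, so `f` is trivial.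
  have hlt := FreeGroup.norm_add_norm_lt hs hs one_ne_zero
  rw [ht, FreeGroup.norm_of] at hlt
  obtain rfl : f = 1 := FreeGroup.norm_eq_zero.1 (by omega)
  refine ⟨FreeGroup.of_injective (by simpa using ht), a, by rw [mul_one]⟩

/-! ### The distance between lines -/

/-- The distance in the Cayley tree of the lines that two elements of the free quandle stand for:
the least word distance of representatives of the two cosets. -/
noncomputable def lineDist (k k' : FreeQuandle α) : ℕ :=
  sInf {n | ∃ g s h t, k = translate g s ∧ k' = translate h t ∧ n = (g⁻¹ * h).norm}

theorem exists_lineDist_eq (k k' : FreeQuandle α) :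
    ∃ g s h t, k = translate g s ∧ k' = translate h t ∧ lineDist k k' = (g⁻¹ * h).norm := by
  obtain ⟨g, s, hk⟩ := exists_eq_translate k
  obtain ⟨h, t, hk'⟩ := exists_eq_translate k'
  exact Nat.sInf_mem (s := {n | ∃ g s h t, k = translate g s ∧ k' = translate h t ∧
    n = (g⁻¹ * h).norm}) ⟨_, g, s, h, t, hk, hk', rfl⟩

theorem lineDist_translate_le (g h : FreeGroup α) (s t : α) :
    lineDist (translate g s) (translate h t) ≤ (g⁻¹ * h).norm :=
  Nat.sInf_le ⟨g, s, h, t, rfl, rfl, rfl⟩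

theorem lineDist_self (k : FreeQuandle α) : lineDist k k = 0 := by
  obtain ⟨g, s, rfl⟩ := exists_eq_translate k
  simpa using lineDist_translate_le g g s s

theorem lineDist_groupAct (c : FreeGroup α) (k k' : FreeQuandle α) :
    lineDist (groupAct c k) (groupAct c k') = lineDist k k' := by
  have H : ∀ (c : FreeGroup α) (k k' : FreeQuandle α),
      lineDist (groupAct c k) (groupAct c k') ≤ lineDist k k' := by
    intro c k k'
    obtain ⟨g, s, h, t, rfl, rfl, e⟩ := exists_lineDist_eq k k'
    rw [e, groupAct_translate, groupAct_translate]
    refine (lineDist_translate_le _ _ _ _).trans_eq ?_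
    congr 1
    group
  refine le_antisymm (H c k k') ?_
  simpa using H c⁻¹ (groupAct c k) (groupAct c k')

theorem lineDist_act (m k k' : FreeQuandle α) :
    lineDist (Shelf.act m k) (Shelf.act m k') = lineDist k k' := by
  obtain ⟨c, r, rfl⟩ := exists_eq_translate m
  rw [act_translate, act_translate, lineDist_groupAct]

/-- The line of `k` differs from that of `translate h y`, and its nearest point there
is `h * y ^ a`. -/
def ProjectsTo (h : FreeGroup α) (y : α) (k : FreeQuandle α) (a : ℤ) : Prop :=
  ∃ f x, k = translate (h * FreeGroup.of y ^ a * f) x ∧ f.AvoidsHead y ∧ ¬(x = y ∧ f = 1)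

theorem exists_projectsTo {h : FreeGroup α} {y : α} {k : FreeQuandle α}
    (hk : k ≠ translate h y) : ∃ a, ProjectsTo h y k a := by
  obtain ⟨g, x, rfl⟩ := exists_eq_translate k
  obtain ⟨a, f, hf, hy⟩ := FreeGroup.exists_eq_zpow_mul y (h⁻¹ * g)
  have hg : h * FreeGroup.of y ^ a * f = g := by rw [mul_assoc, ← hf, mul_inv_cancel_left]
  refine ⟨a, f, x, by rw [hg], hy, ?_⟩
  rintro ⟨rfl, rfl⟩
  rw [← hg, mul_one, translate_mul_zpow] at hk
  exact hk rfl

theorem ProjectsTo.act {h : FreeGroup α} {y : α} {k : FreeQuandle α} {a : ℤ}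
    (hk : ProjectsTo h y k a) : ProjectsTo h y (Shelf.act (translate h y) k) (a + 1) := by
  obtain ⟨f, x, rfl, hf, hx⟩ := hk
  refine ⟨f, x, ?_, hf, hx⟩
  rw [act_translate, groupAct_translate]
  congr 1
  rw [add_comm, zpow_add, zpow_one]
  group

/-- The path between two lines with different nearest points on a third line runs along the
third line for at least one edge. -/
theorem lineDist_lt_of_ne {h : FreeGroup α} {y : α} {k k' : FreeQuandle α} {a b : ℤ}
    (hk : ProjectsTo h y k a) (hk' : ProjectsTo h y k' b) (hab : a ≠ b) :
    lineDist k (translate h y) < lineDist k k' := by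
  obtain ⟨f, x, hkf, hf, hx⟩ := hk
  obtain ⟨f', x', hkf', hf', hx'⟩ := hk'
  obtain ⟨g, s, g', s', rfl, rfl, e⟩ := exists_lineDist_eq k k'
  obtain ⟨rfl, i, rfl⟩ := eq_of_translate_eq hkf.symm
  obtain ⟨rfl, j, rfl⟩ := eq_of_translate_eq hkf'.symm
  have hlt := FreeGroup.norm_add_norm_lt (hf.mul_zpow hx i) (hf'.mul_zpow hx' j)
    (sub_ne_zero.2 hab.symm)
  have hle : lineDist (translate (h * FreeGroup.of y ^ a * f * FreeGroup.of x ^ i) x)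
      (translate h y) ≤ (f * FreeGroup.of x ^ i).norm := by
    rw [← translate_mul_zpow h y a, ← FreeGroup.norm_inv_eq]
    refine (lineDist_translate_le _ _ _ _).trans_eq ?_
    congr 1
    group
  refine (hle.trans (Nat.le_add_right _ _)).trans_lt (hlt.trans_eq ?_)
  rw [e]
  congr 1
  rw [sub_eq_neg_add, zpow_add, zpow_neg]
  group

/-- A finite set with at least two elements has a product that leaves the set and that is a
product of elements of the set in only one way. -/
theorem exists_uniqueProduct_notMem {A : Finset (FreeQuandle α)} (hA : A.Nontrivial) :
    ∃ l ∈ A, ∃ m ∈ A, Shelf.act m l ∉ A ∧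
      ∀ l' ∈ A, ∀ m' ∈ A, Shelf.act m' l' = Shelf.act m l → l' = l ∧ m' = m := by
  obtain ⟨⟨l, m⟩, hlm, hmax⟩ := A.offDiag.exists_max_image (fun p => lineDist p.1 p.2)
    (by
      obtain ⟨a, ha, b, hb, hab⟩ := hA
      exact ⟨(a, b), Finset.mem_offDiag.2 ⟨ha, hb, hab⟩⟩)
  obtain ⟨hl, hm, hne⟩ : l ∈ A ∧ m ∈ A ∧ l ≠ m := Finset.mem_offDiag.1 hlm
  have hle : ∀ k ∈ A, ∀ k' ∈ A, lineDist k k' ≤ lineDist l m := by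
    intro k hk k' hk'
    by_cases h : k = k'
    · rw [h, lineDist_self]
      exact Nat.zero_le _
    · exact hmax (k, k') (Finset.mem_offDiag.2 ⟨hk, hk', h⟩)
  obtain ⟨h, y, rfl⟩ := exists_eq_translate m
  obtain ⟨p, hp⟩ := exists_projectsTo hne
  have hp' := hp.act
  refine ⟨l, hl, translate h y, hm, fun hmem => ?_, fun l' hl' m' hm' e => ?_⟩
  · exact absurd (hle l hl _ hmem) (lineDist_lt_of_ne hp hp' (by omega)).not_ge
  · by_cases hmm : m' = translate h y
    · subst hmm
      exact ⟨(Rack.left_cancel _).1 e, rfl⟩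
    obtain ⟨q, hq⟩ := exists_projectsTo hmm
    exfalso
    by_cases hqp : q = p
    · have h1 := lineDist_lt_of_ne hp' hq (by omega)
      have h2 := lineDist_act (translate h y) l (translate h y)
      rw [Quandle.fix] at h2
      have h3 := lineDist_act m' l' m'
      rw [e, Quandle.fix] at h3
      have h4 := hle l' hl' m' hm'
      omega
    · exact absurd (hle l hl m' hm') (lineDist_lt_of_ne hp hq (Ne.symm hqp)).not_ge

end FreeQuandle

/-! ### Idempotents -/

namespace QuandleRing

theorem mulAux_single_self {X : Type*} [Quandle X] (x : X) (a b : ℤ) :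
    (mulAux (Finsupp.single x a) (Finsupp.single x b) : X →₀ ℤ) = Finsupp.single x (a * b) := by
  simp [mulAux, Quandle.fix]

theorem mulAux_apply_of_unique {X : Type*} [Quandle X] {u v : X →₀ ℤ} {l m : X}
    (h : ∀ l' ∈ u.support, ∀ m' ∈ v.support, Shelf.act m' l' = Shelf.act m l → l' = l ∧ m' = m) :
    mulAux u v (Shelf.act m l) = u l * v m := by
  classical
  simp only [mulAux, Finsupp.sum, Finsupp.finsetSum_apply, Finsupp.single_apply]
  rw [Finset.sum_eq_single l, Finset.sum_eq_single m]
  · simp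
  · intro m' hm' hne
    by_cases hl : l ∈ u.support
    · exact if_neg fun e => hne (h l hl m' hm' e).2
    · simp [Finsupp.notMem_support_iff.1 hl]
  · intro hm
    simp [Finsupp.notMem_support_iff.1 hm]
  · intro l' hl' hne
    exact Finset.sum_eq_zero fun m' hm' => if_neg fun e => hne (h l' hl' m' hm' e).1
  · intro hl
    simp [Finsupp.notMem_support_iff.1 hl]

theorem idempotents_freeQuandle (α : Type*) :
    idempotents ℤ (FreeQuandle α) = Set.range fun x : FreeQuandle α => e ℤ x := by
  classical
  ext u
  constructor
  · rintro ⟨hu0, huu⟩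
    change FreeQuandle α →₀ ℤ at u
    replace hu0 : u ≠ 0 := hu0
    replace huu : mulAux u u = u := huu
    rcases (Finsupp.support_nonempty_iff.2 hu0).exists_eq_singleton_or_nontrivial with
      ⟨x, hx⟩ | hA
    · obtain ⟨a, ha, rfl⟩ := Finsupp.support_eq_singleton'.1 hx
      rw [mulAux_single_self, (Finsupp.single_injective x).eq_iff] at huu
      exact ⟨x, by rw [mul_left_eq_self₀.1 huu |>.resolve_right ha]; rfl⟩
    · obtain ⟨l, hl, m, hm, hlm, huniq⟩ := FreeQuandle.exists_uniqueProduct_notMem hA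
      have h := mulAux_apply_of_unique huniq
      rw [huu, Finsupp.notMem_support_iff.1 hlm] at h
      exact absurd h.symm
        (mul_ne_zero (Finsupp.mem_support_iff.1 hl) (Finsupp.mem_support_iff.1 hm))
  · rintro ⟨x, rfl⟩
    refine ⟨fun h => one_ne_zero (Finsupp.single_eq_zero.1 h), ?_⟩
    exact (mulAux_single_self x 1 1).trans (by rw [mul_one]; rfl)

end QuandleRing

theorem theorem5p3 (n : ℕ) (hn : 1 ≤ n) :
    QuandleRing.idempotents ℤ (FreeQuandle (Fin n)) =
      Set.range (fun x : FreeQuandle (Fin n) => QuandleRing.e ℤ x) :=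
  QuandleRing.idempotents_freeQuandle (Fin n)
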